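/- Let $G$ be a finite simple graph and let $D$ be an orientation of $G$. Write $\vec E(D)$ for the set of directed edges of $D$ and $d^+_D(v)$ for the out-degree of $v$ in $D$; let $N_D(v)$ be the set of vertices joined to $v$ by an edge of $D$ in either direction, and $N_D[v]=N_D(v)\cup\{v\}$. Let $\mathcal W(D)$ be the following digraph. Its vertices are pairwise distinct symbols: $x^*$ for each vertex $x$ of $D$; $x^{vw}$ for each $vw\in\vec E(D)$ and each $x\in N_D(v)\,\triangle\,N_D(w)$; and $y^{vw}_x$ for each $vw\in\vec E(D)$ and each $x\in N_D(w)\setminus N_D[v]$. Its directed edges are, for each $vw\in\vec E(D)$: $v^*\to v^{vw}$; $v^{vw}\to x^{vw}$ for each $x\in N_D(v)\setminus N_D(w)$; $v^{vw}\to y^{vw}_x$ and $y^{vw}_x\to x^{vw}$ for each $x\in N_D(w)\setminus N_D[v]$; and $x^{vw}\to x^*$ for each $x\in N_D(v)\,\triangle\,N_D(w)$ with $x\neq v$. A digraph is called Eulerian if the in-degree and the out-degree agree at every vertex (it need not be connected). Let $EE(\mathcal W(D))$ and $EO(\mathcal W(D))$ be the numbers of spanning Eulerian subdigraphs of $\mathcal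 W(D)$ (same vertex set, a subset of the edges) with an even and with an odd number of edges, respectively. For each vertex $v$ of $G$ let $L(v)$ be a set of $d^+_D(v)+1$ positive integers. If $EE(\mathcal W(D))\neq EO(\mathcal W(D))$, then there is a function $\ell$ with $\ell(v)\in L(v)$ for every vertex $v$ that is an additive coloring of $G$; that is, $\sum_{x\in N_G(u)}\ell(x)\neq\sum_{x\in N_G(v)}\ell(x)$ whenever $u$ and $v$ are adjacent in $G$. -/

import Mathlib

namespace AddCol

/-- `D` is an orientation of the simple graph `G`: exactly one of the two directed pairs on each
edge of `G` is a directed edge of `D`, and `D` has no other directed edges. -/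
def IsOrientation {V : Type*} (D : Digraph V) (G : SimpleGraph V) : Prop :=
  (∀ v w, G.Adj v w ↔ D.Adj v w ∨ D.Adj w v) ∧ ∀ v w, D.Adj v w → ¬ D.Adj w v

/-- The out-degree of `v`. -/
noncomputable def outDeg {V : Type*} [Finite V] (D : Digraph V) (v : V) : ℕ :=
  {w | D.Adj v w}.ncard

/-- The in-degree of `v`. -/
noncomputable def inDeg {V : Type*} [Finite V] (D : Digraph V) (v : V) : ℕ :=
  {u | D.Adj u v}.ncard

/-- The number of directed edges. -/
noncomputable def numEdges {V : Type*} [Finite V] (D : Digraph V) : ℕ :=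
  {p : V × V | D.Adj p.1 p.2}.ncard

/-- A digraph is Eulerian if out-degree and in-degree agree at each vertex
(connectedness is not required). -/
def IsEulerian {V : Type*} [Finite V] (D : Digraph V) : Prop :=
  ∀ v, outDeg D v = inDeg D v

/-- The number of spanning Eulerian subdigraphs of `D` with an even number of edges. Digraphs on
the same vertex type are ordered by inclusion of their edge sets, so the `S ≤ D` are exactly the
spanning subdigraphs of `D`. -/
noncomputable def EE {V : Type*} [Finite V] (D : Digraph V) : ℕ :=
  {S : Digraph V | S ≤ D ∧ IsEulerian S ∧ Even (numEdges S)}.ncard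

/-- The number of spanning Eulerian subdigraphs of `D` with an odd number of edges. -/
noncomputable def EO {V : Type*} [Finite V] (D : Digraph V) : ℕ :=
  {S : Digraph V | S ≤ D ∧ IsEulerian S ∧ Odd (numEdges S)}.ncard

/-- `N_D(v)`: the vertices adjacent to `v` in `D`, in either direction. -/
def nbr {V : Type*} (D : Digraph V) (v : V) : Set V :=
  {u | D.Adj v u ∨ D.Adj u v}

/-- The vertices of the digraph `𝒲(D)`. -/
inductive WVertex {V : Type*} (D : Digraph V) : Type _
  /-- the vertex `x^*` -/
  | star (x : V) : WVertex D
  /-- the vertex `x^{vw}` of the `vw`-sector, for a directed edge `vw` and `x` in the symmetric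
  difference of `N_D(v)` and `N_D(w)` -/
  | copy (v w : V) (e : D.Adj v w) (x : V) (hx : x ∈ symmDiff (nbr D v) (nbr D w)) : WVertex D
  /-- the vertex `y^{vw}_x` of the `vw`-sector, for a directed edge `vw` and
  `x ∈ N_D(w) \ N_D[v]` -/
  | mid (v w : V) (e : D.Adj v w) (x : V) (hx : x ∈ nbr D w \ insert v (nbr D v)) : WVertex D

instance {V : Type*} [Finite V] (D : Digraph V) : Finite (WVertex D) := by
  let f : WVertex D → V ⊕ (V × V × V) ⊕ (V × V × V) := fun a => match a with
    | .star x => .inl x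
    | .copy v w _ x _ => .inr (.inl (v, w, x))
    | .mid v w _ x _ => .inr (.inr (v, w, x))
  refine Finite.of_injective f ?_
  rintro (_ | _ | _) (_ | _ | _) h <;> simp_all [f]

/-- The directed edges of `𝒲(D)`. The membership proofs `hv`, `hx` only record that the vertices
in question exist. -/
inductive WAdj {V : Type*} (D : Digraph V) : WVertex D → WVertex D → Prop
  /-- `v^{vw} → x^{vw}` for `x ∈ N_D(v) \ N_D(w)` -/
  | direct (v w : V) (e : D.Adj v w) (x : V) (h : x ∈ nbr D v \ nbr D w)
      (hv : v ∈ symmDiff (nbr D v) (nbr D w)) (hx : x ∈ symmDiff (nbr D v) (nbr D w)) :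
      WAdj D (.copy v w e v hv) (.copy v w e x hx)
  /-- `v^{vw} → y^{vw}_x` for `x ∈ N_D(w) \ N_D[v]` -/
  | toMid (v w : V) (e : D.Adj v w) (x : V) (h : x ∈ nbr D w \ insert v (nbr D v))
      (hv : v ∈ symmDiff (nbr D v) (nbr D w)) :
      WAdj D (.copy v w e v hv) (.mid v w e x h)
  /-- `y^{vw}_x → x^{vw}` for `x ∈ N_D(w) \ N_D[v]` -/
  | fromMid (v w : V) (e : D.Adj v w) (x : V) (h : x ∈ nbr D w \ insert v (nbr D v))
      (hx : x ∈ symmDiff (nbr D v) (nbr D w)) :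
      WAdj D (.mid v w e x h) (.copy v w e x hx)
  /-- `v^* → v^{vw}` -/
  | enter (v w : V) (e : D.Adj v w) (hv : v ∈ symmDiff (nbr D v) (nbr D w)) :
      WAdj D (.star v) (.copy v w e v hv)
  /-- `x^{vw} → x^*` for `x ≠ v` -/
  | leave (v w : V) (e : D.Adj v w) (x : V) (hx : x ∈ symmDiff (nbr D v) (nbr D w))
      (hne : x ≠ v) :
      WAdj D (.copy v w e x hx) (.star x)

/-- The digraph `𝒲(D)`. -/
def W {V : Type*} (D : Digraph V) : Digraph (WVertex D) where
  Adj := WAdj D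

open Classical in
/-- A labeling of the vertices by positive integers is an additive coloring if the sums of the
labels over the neighborhoods of any two adjacent vertices differ. -/
def IsAdditiveColoring {V : Type*} [Fintype V] (G : SimpleGraph V) (l : V → ℕ+) : Prop :=
  ∀ u v, G.Adj u v →
    ∑ x ∈ G.neighborFinset u, (l x : ℕ) ≠ ∑ x ∈ G.neighborFinset v, (l x : ℕ)

end AddCol

/-! Let `P` be the product over the directed edges vw of ∑_{x∈N(v)} X_x − ∑_{x∈N(w)} X_x. Labels at
which `P` does not vanish form an additive coloring. `P` has total degree at most |E(D)| = ∑ d⁺(v),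
so by the Combinatorial Nullstellensatz it suffices that the coefficient of ∏ X_v^{d⁺(v)} is
nonzero.

That coefficient is a signed count of selections `c`: each edge vw picks x in N(v) △ N(w), and each
vertex x is picked d⁺(x) times. A selection is routed through 𝒲(D) as one path v* → v^{vw} → … → x*
per edge vw, or none if x = v (`flow`). The result is Eulerian exactly when the counts are right
(`isEulerian_flow_iff`), and every Eulerian subdigraph arises once (`flow_injOn`, `exists_flow_eq`).
The path has 3 edges if x ∈ N(v), 4 if x ∈ N(w) \ N[v], and 0 if x = v, so parity records the sign
in `P` up to one global factor per edge. Hence the coefficient is ±(EE − EO). -/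

namespace AddCol

/-- The directed edges of `D`, as a type. -/
abbrev Edge {V : Type*} (D : Digraph V) : Type _ := {p : V × V // D.Adj p.1 p.2}

/-! ### In- and out-neighbors in 𝒲(D) -/

section Sectors

variable {V : Type*} {D : Digraph V}

lemma mem_symmDiff_nbr_tail (hD : ∀ v w, D.Adj v w → ¬ D.Adj w v) {v w : V} (e : D.Adj v w) :
    v ∈ symmDiff (nbr D v) (nbr D w) := by
  refine Set.mem_symmDiff.2 (Or.inr ⟨Or.inr e, ?_⟩)
  rintro (h | h) <;> exact hD _ _ h h

lemma ne_tail_of_mem_direct {v w x : V} (e : D.Adj v w) (h : x ∈ nbr D v \ nbr D w) : x ≠ v := by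
  rintro rfl
  exact h.2 (Or.inr e)

lemma ne_tail_of_mem_mid {v w x : V} (h : x ∈ nbr D w \ insert v (nbr D v)) : x ≠ v :=
  fun hx => h.2 (Or.inl hx)

lemma mem_symmDiff_of_mem_mid {v w x : V} (h : x ∈ nbr D w \ insert v (nbr D v)) :
    x ∈ symmDiff (nbr D v) (nbr D w) :=
  Set.mem_symmDiff.2 (Or.inr ⟨h.1, fun hx => h.2 (Or.inr hx)⟩)

lemma mem_direct_or_mem_mid {v w x : V} (hx : x ∈ symmDiff (nbr D v) (nbr D w)) (hne : x ≠ v) :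
    x ∈ nbr D v \ nbr D w ∨ x ∈ nbr D w \ insert v (nbr D v) := by
  rcases Set.mem_symmDiff.1 hx with h | h
  · exact Or.inl h
  · exact Or.inr ⟨h.1, fun h' => h'.elim hne h.2⟩

lemma wAdj_star_left {x : V} {b : WVertex D} :
    WAdj D (.star x) b ↔ ∃ w e hv, b = .copy x w e x hv := by
  constructor
  · rintro ⟨⟩
    exact ⟨_, _, _, rfl⟩
  · rintro ⟨w, e, hv, rfl⟩
    exact .enter ..

lemma wAdj_star_right {x : V} {a : WVertex D} :
    WAdj D a (.star x) ↔ ∃ v w e hx, x ≠ v ∧ a = .copy v w e x hx := by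
  constructor
  · rintro ⟨⟩
    exact ⟨_, _, _, _, ‹_›, rfl⟩
  · rintro ⟨v, w, e, hx, hne, rfl⟩
    exact .leave _ _ _ _ _ hne

lemma wAdj_root_right {v w : V} {e : D.Adj v w} {hv} {a : WVertex D} :
    WAdj D a (.copy v w e v hv) ↔ a = .star v := by
  constructor
  · intro h
    cases h with
    | direct _ _ _ _ h => exact (ne_tail_of_mem_direct e h rfl).elim
    | fromMid _ _ _ _ h => exact (ne_tail_of_mem_mid h rfl).elim
    | enter => rfl
  · rintro rfl
    exact .enter ..

lemma wAdj_root_left {v w : V} {e : D.Adj v w} {hv} {b : WVertex D} :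
    WAdj D (.copy v w e v hv) b ↔
      (∃ x, ∃ _ : x ∈ nbr D v \ nbr D w, ∃ hx, b = .copy v w e x hx) ∨
        ∃ x h, b = .mid v w e x h := by
  constructor
  · intro h
    cases h with
    | direct _ _ _ x h _ hx => exact Or.inl ⟨x, h, hx, rfl⟩
    | toMid _ _ _ x h => exact Or.inr ⟨x, h, rfl⟩
    | leave _ _ _ _ _ h => exact (h rfl).elim
  · rintro (⟨x, h, hx, rfl⟩ | ⟨x, h, rfl⟩)
    · exact .direct _ _ _ _ h _ _
    · exact .toMid ..

lemma wAdj_copy_left {v w x : V} {e : D.Adj v w} {hx} (hne : x ≠ v) {b : WVertex D} :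
    WAdj D (.copy v w e x hx) b ↔ b = .star x := by
  constructor
  · intro h
    cases h with
    | direct => exact (hne rfl).elim
    | toMid => exact (hne rfl).elim
    | leave => rfl
  · rintro rfl
    exact .leave _ _ _ _ _ hne

lemma wAdj_copy_right_of_direct {v w x : V} {e : D.Adj v w} {hx} (h : x ∈ nbr D v \ nbr D w)
    (hv : v ∈ symmDiff (nbr D v) (nbr D w)) {a : WVertex D} :
    WAdj D a (.copy v w e x hx) ↔ a = .copy v w e v hv := by
  constructor
  · intro h'
    cases h' with
    | direct => rfl
    | fromMid _ _ _ _ h' => exact (h.2 h'.1).elim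
    | enter => exact (ne_tail_of_mem_direct e h rfl).elim
  · rintro rfl
    exact .direct _ _ _ _ h _ _

lemma wAdj_copy_right_of_mid {v w x : V} {e : D.Adj v w} {hx}
    (h : x ∈ nbr D w \ insert v (nbr D v)) {a : WVertex D} :
    WAdj D a (.copy v w e x hx) ↔ a = .mid v w e x h := by
  constructor
  · intro h'
    cases h' with
    | direct _ _ _ _ h' => exact (h'.2 h.1).elim
    | fromMid => rfl
    | enter => exact (ne_tail_of_mem_mid h rfl).elim
  · rintro rfl
    exact .fromMid ..

lemma wAdj_mid_left {v w x : V} {e : D.Adj v w} {h}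
    (hx : x ∈ symmDiff (nbr D v) (nbr D w)) {b : WVertex D} :
    WAdj D (.mid v w e x h) b ↔ b = .copy v w e x hx := by
  constructor
  · rintro ⟨⟩
    rfl
  · rintro rfl
    exact .fromMid ..

lemma wAdj_mid_right {v w x : V} {e : D.Adj v w} {h}
    (hv : v ∈ symmDiff (nbr D v) (nbr D w)) {a : WVertex D} :
    WAdj D a (.mid v w e x h) ↔ a = .copy v w e v hv := by
  constructor
  · rintro ⟨⟩
    rfl
  · rintro rfl
    exact .toMid ..

end Sectors

/-! ### Selections and their flows -/

section Selection

variable {V : Type*} {D : Digraph V}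

/-- A selection picks for each directed edge `vw` a vertex of the symmetric difference of the
neighborhoods of `v` and `w`. -/
def IsSelection (c : Edge D → V) : Prop :=
  ∀ e : Edge D, c e ∈ symmDiff (nbr D e.1.1) (nbr D e.1.2)

/-- The vertices of `𝒲(D)` through which the flow given by `c` passes: in the `vw`-sector, it runs
from `v^{vw}` to `x^{vw}` with `x = c vw`, and there is none if `c vw = v`. -/
def Active (c : Edge D → V) : WVertex D → Prop
  | .star _ => True
  | .copy v w e x _ => (x = v ∧ c ⟨(v, w), e⟩ ≠ v) ∨ (x ≠ v ∧ c ⟨(v, w), e⟩ = x)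
  | .mid v w e x _ => c ⟨(v, w), e⟩ = x

/-- The subdigraph of `𝒲(D)` induced on the active vertices. -/
def flow (c : Edge D → V) : Digraph (WVertex D) where
  Adj a b := WAdj D a b ∧ Active c a ∧ Active c b

lemma flow_le (c : Edge D → V) : flow c ≤ W D := fun _ _ h => h.1

lemma active_star (c : Edge D → V) (x : V) : Active c (.star x) := trivial

lemma active_root {c : Edge D → V} {v w : V} {e : D.Adj v w} {hv} :
    Active c (.copy v w e v hv) ↔ c ⟨(v, w), e⟩ ≠ v := by
  simp [Active]

lemma active_copy {c : Edge D → V} {v w x : V} {e : D.Adj v w} {hx} (hne : x ≠ v) :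
    Active c (.copy v w e x hx) ↔ c ⟨(v, w), e⟩ = x := by
  simp [Active, hne]

lemma active_mid {c : Edge D → V} {v w x : V} {e : D.Adj v w} {hx} :
    Active c (.mid v w e x hx) ↔ c ⟨(v, w), e⟩ = x := Iff.rfl

lemma flow_leave {c : Edge D → V} {v w x : V} {e : D.Adj v w} {hx} (hne : x ≠ v) :
    (flow c).Adj (.copy v w e x hx) (.star x) ↔ c ⟨(v, w), e⟩ = x := by
  simp [flow, active_copy hne, active_star, wAdj_copy_left hne]

lemma flow_enter {c : Edge D → V} {v w : V} {e : D.Adj v w} {hv} :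
    (flow c).Adj (.star v) (.copy v w e v hv) ↔ c ⟨(v, w), e⟩ ≠ v := by
  simp [flow, active_root, active_star, wAdj_root_right]

/-- Any choice other than the tail can be read off from the edge returning to a star vertex; the
tail is the choice when there is no such edge. -/
lemma flow_injOn : Set.InjOn (flow (D := D)) {c | IsSelection c} := by
  have key : ∀ c c' : Edge D → V, IsSelection c → flow c = flow c' →
      ∀ e, c e ≠ e.1.1 → c' e = c e := by
    rintro c c' hc h ⟨⟨v, w⟩, e⟩ hne
    have := (flow_leave (hx := hc ⟨(v, w), e⟩) hne).2 rfl
    rw [h] at this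
    exact (flow_leave hne).1 this
  intro c hc c' hc' h
  funext e
  by_cases h1 : c e = e.1.1
  · by_cases h2 : c' e = e.1.1
    · rw [h1, h2]
    · exact key c' c hc' h.symm e h2
  · exact (key c c' hc h e h1).symm

lemma existsUnique_flow_out {c : Edge D → V}
    (hc : IsSelection c) {a : WVertex D} (ha : Active c a) (hs : ∀ x, a ≠ .star x) :
    ∃! b, (flow c).Adj a b := by
  cases a with
  | star x => exact (hs x rfl).elim
  | copy v w e x hx =>
    by_cases hxv : x = v
    · subst hxv
      have hne := active_root.1 ha
      have hcx := hc ⟨(x, w), e⟩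
      rcases mem_direct_or_mem_mid hcx hne with h | h
      · refine ⟨.copy x w e _ hcx, ⟨.direct _ _ _ _ h _ _, ha, (active_copy hne).2 rfl⟩, ?_⟩
        rintro b ⟨hb, -, hb'⟩
        rcases wAdj_root_left.1 hb with ⟨y, hy, hy', rfl⟩ | ⟨y, hy, rfl⟩
        · obtain rfl := (active_copy (ne_tail_of_mem_direct e hy)).1 hb'
          rfl
        · obtain rfl := active_mid.1 hb'
          exact (h.2 hy.1).elim
      · refine ⟨.mid x w e _ h, ⟨.toMid .., ha, active_mid.2 rfl⟩, ?_⟩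
        rintro b ⟨hb, -, hb'⟩
        rcases wAdj_root_left.1 hb with ⟨y, hy, hy', rfl⟩ | ⟨y, hy, rfl⟩
        · obtain rfl := (active_copy (ne_tail_of_mem_direct e hy)).1 hb'
          exact (hy.2 h.1).elim
        · obtain rfl := active_mid.1 hb'
          rfl
    · exact ⟨.star x, ⟨.leave _ _ _ _ _ hxv, ha, trivial⟩,
        fun b hb => (wAdj_copy_left hxv).1 hb.1⟩
  | mid v w e x h =>
    have hx := mem_symmDiff_of_mem_mid h
    exact ⟨.copy v w e x hx, ⟨.fromMid .., ha, (active_copy (ne_tail_of_mem_mid h)).2 ha⟩,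
      fun b hb => (wAdj_mid_left hx).1 hb.1⟩

lemma existsUnique_flow_in (hD : ∀ v w, D.Adj v w → ¬ D.Adj w v) {c : Edge D → V}
    {b : WVertex D} (hb : Active c b) (hs : ∀ x, b ≠ .star x) :
    ∃! a, (flow c).Adj a b := by
  cases b with
  | star x => exact (hs x rfl).elim
  | copy v w e x hx =>
    by_cases hxv : x = v
    · subst hxv
      exact ⟨.star x, ⟨.enter .., trivial, hb⟩, fun a ha => wAdj_root_right.1 ha.1⟩
    · have hcx := (active_copy hxv).1 hb
      rcases mem_direct_or_mem_mid hx hxv with h | h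
      · have hv := mem_symmDiff_nbr_tail hD e
        exact ⟨.copy v w e v hv, ⟨.direct _ _ _ _ h _ _, active_root.2 (hcx ▸ hxv), hb⟩,
          fun a ha => (wAdj_copy_right_of_direct h hv).1 ha.1⟩
      · exact ⟨.mid v w e x h, ⟨.fromMid .., active_mid.2 hcx, hb⟩,
          fun a ha => (wAdj_copy_right_of_mid h).1 ha.1⟩
  | mid v w e x h =>
    have hv := mem_symmDiff_nbr_tail hD e
    exact ⟨.copy v w e v hv,
      ⟨.toMid .., active_root.2 (active_mid.1 hb ▸ ne_tail_of_mem_mid h), hb⟩,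
      fun a ha => (wAdj_mid_right hv).1 ha.1⟩

end Selection

/-! ### The balance condition for a flow -/

section Degrees

variable {V : Type*} [Finite V] {D : Digraph V}

lemma ncard_eq_one_of_existsUnique {α : Type*} {p : α → Prop} (h : ∃! a, p a) :
    {a | p a}.ncard = 1 := by
  obtain ⟨a, ha, hu⟩ := h
  exact Set.ncard_eq_one.2 ⟨a, Set.eq_singleton_iff_unique_mem.2 ⟨ha, hu⟩⟩

lemma outDeg_flow_eq_inDeg_flow (hD : ∀ v w, D.Adj v w → ¬ D.Adj w v) {c : Edge D → V}
    (hc : IsSelection c) {a : WVertex D} (hs : ∀ x, a ≠ .star x) :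
    outDeg (flow c) a = inDeg (flow c) a := by
  by_cases ha : Active c a
  · rw [outDeg, inDeg, ncard_eq_one_of_existsUnique (existsUnique_flow_out hc ha hs),
      ncard_eq_one_of_existsUnique (existsUnique_flow_in hD ha hs)]
  · simp [outDeg, inDeg, flow, ha]

lemma outDeg_flow_star (hD : ∀ v w, D.Adj v w → ¬ D.Adj w v) (c : Edge D → V) (x : V) :
    outDeg (flow c) (.star x) = {e : Edge D | e.1.1 = x ∧ c e ≠ x}.ncard := by
  symm
  refine Set.ncard_congr
    (fun e _ => .copy e.1.1 e.1.2 e.2 e.1.1 (mem_symmDiff_nbr_tail hD e.2)) ?_ ?_ ?_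
  · rintro ⟨⟨v, w⟩, e⟩ ⟨rfl, h⟩
    exact flow_enter.2 h
  · rintro ⟨⟨v, w⟩, e⟩ ⟨⟨v', w'⟩, e'⟩ - - h
    simp only [WVertex.copy.injEq] at h
    obtain ⟨rfl, rfl, -⟩ := h
    rfl
  · rintro b hb
    obtain ⟨w, e, hv, rfl⟩ := wAdj_star_left.1 hb.1
    exact ⟨⟨(x, w), e⟩, ⟨rfl, active_root.1 hb.2.2⟩, rfl⟩

lemma inDeg_flow_star {c : Edge D → V} (hc : IsSelection c) (x : V) :
    inDeg (flow c) (.star x) = {e : Edge D | e.1.1 ≠ x ∧ c e = x}.ncard := by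
  symm
  refine Set.ncard_congr (fun e _ => .copy e.1.1 e.1.2 e.2 (c e) (hc e)) ?_ ?_ ?_
  · rintro ⟨⟨v, w⟩, e⟩ ⟨hne, rfl⟩
    exact (flow_leave hne.symm).2 rfl
  · rintro ⟨⟨v, w⟩, e⟩ ⟨⟨v', w'⟩, e'⟩ - - h
    simp only [WVertex.copy.injEq] at h
    obtain ⟨rfl, rfl, -⟩ := h
    rfl
  · rintro b hb
    obtain ⟨v, w, e, hx, hne, rfl⟩ := wAdj_star_right.1 hb.1
    obtain rfl := (active_copy hne).1 hb.2.1
    exact ⟨⟨(v, w), e⟩, ⟨hne.symm, rfl⟩, rfl⟩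

lemma outDeg_eq_ncard_edge (x : V) : outDeg D x = {e : Edge D | e.1.1 = x}.ncard := by
  refine Set.ncard_congr (fun w hw => ⟨(x, w), hw⟩) (fun _ _ => rfl) ?_ ?_
  · intro w w' _ _ h
    simpa using h
  · rintro ⟨⟨v, w⟩, e⟩ rfl
    exact ⟨w, e, rfl⟩

/-- Only star vertices matter, since a flow is always balanced elsewhere. At x*, the paths leaving
come from edges with tail x that do not pick x, and the paths arriving from edges with another tail
that pick x. Adding to both the edges with tail x that pick x turns these counts into d⁺(x) and the
number of times x is picked. -/
lemma isEulerian_flow_iff (hD : ∀ v w, D.Adj v w → ¬ D.Adj w v) {c : Edge D → V}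
    (hc : IsSelection c) :
    IsEulerian (flow c) ↔ ∀ x, {e | c e = x}.ncard = outDeg D x := by
  have key : ∀ x, outDeg (flow c) (.star x) = inDeg (flow c) (.star x) ↔
      {e | c e = x}.ncard = outDeg D x := by
    intro x
    rw [outDeg_flow_star hD, inDeg_flow_star hc, outDeg_eq_ncard_edge]
    have h1 := Set.ncard_inter_add_ncard_sdiff_eq_ncard {e : Edge D | e.1.1 = x} {e | c e = x}
    have h2 := Set.ncard_inter_add_ncard_sdiff_eq_ncard {e | c e = x} {e : Edge D | e.1.1 = x}
    rw [Set.inter_comm] at h2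
    have h3 : {e : Edge D | e.1.1 = x} \ {e | c e = x} = {e | e.1.1 = x ∧ c e ≠ x} := rfl
    have h4 : {e | c e = x} \ {e : Edge D | e.1.1 = x} = {e | e.1.1 ≠ x ∧ c e = x} :=
      Set.ext fun _ => and_comm
    rw [h3] at h1
    rw [h4] at h2
    omega
  constructor
  · exact fun h x => (key x).1 (h _)
  · intro h a
    by_cases ha : ∃ x, a = .star x
    · obtain ⟨x, rfl⟩ := ha
      exact (key x).2 (h x)
    · exact outDeg_flow_eq_inDeg_flow hD hc (not_exists.1 ha)

end Degrees

/-! ### Every Eulerian subdigraph is a flow -/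

section Eulerian

variable {V : Type*} [Finite V]

lemma adj_iff_adj_of_outDeg_eq_inDeg {S : Digraph V} {a a₀ b₀ : V}
    (h : outDeg S a = inDeg S a) (hout : ∀ b, S.Adj a b → b = b₀)
    (hin : ∀ b, S.Adj b a → b = a₀) : S.Adj a b₀ ↔ S.Adj a₀ a := by
  have h1 : S.Adj a b₀ ↔ 0 < outDeg S a := by
    rw [outDeg, Set.ncard_pos]
    exact ⟨fun h => ⟨_, h⟩, fun ⟨b, hb⟩ => hout b hb ▸ hb⟩
  have h2 : S.Adj a₀ a ↔ 0 < inDeg S a := by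
    rw [inDeg, Set.ncard_pos]
    exact ⟨fun h => ⟨_, h⟩, fun ⟨b, hb⟩ => hin b hb ▸ hb⟩
  rw [h1, h2, h]

variable {D : Digraph V}

/-- The only possible edge into v^{vw} comes from v*, so by balance at most one edge leaves v^{vw}.
Its target determines the choice; with no such edge the choice is v. -/
lemma exists_sector_selection (hD : ∀ v w, D.Adj v w → ¬ D.Adj w v) {S : Digraph (WVertex D)}
    (hS : S ≤ W D) (hE : IsEulerian S) (e : Edge D) :
    ∃ x ∈ symmDiff (nbr D e.1.1) (nbr D e.1.2),
      (∀ hv, S.Adj (.star e.1.1) (.copy e.1.1 e.1.2 e.2 e.1.1 hv) ↔ x ≠ e.1.1) ∧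
      (∀ y, y ∈ nbr D e.1.1 \ nbr D e.1.2 → ∀ hv hy,
        (S.Adj (.copy e.1.1 e.1.2 e.2 e.1.1 hv) (.copy e.1.1 e.1.2 e.2 y hy) ↔ x = y)) ∧
      ∀ y h hv, S.Adj (.copy e.1.1 e.1.2 e.2 e.1.1 hv) (.mid e.1.1 e.1.2 e.2 y h) ↔ x = y := by
  obtain ⟨⟨v, w⟩, e⟩ := e
  dsimp only
  have hv := mem_symmDiff_nbr_tail hD e
  have hin : inDeg S (.copy v w e v hv) = 1 ∧ S.Adj (.star v) (.copy v w e v hv) ∨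
      inDeg S (.copy v w e v hv) = 0 ∧ ¬ S.Adj (.star v) (.copy v w e v hv) := by
    by_cases h : S.Adj (.star v) (.copy v w e v hv)
    · exact Or.inl ⟨ncard_eq_one_of_existsUnique ⟨_, h, fun a ha => wAdj_root_right.1 (hS ha)⟩, h⟩
    · refine Or.inr ⟨?_, h⟩
      rw [inDeg, Set.ncard_eq_zero, Set.eq_empty_iff_forall_notMem]
      intro a ha
      obtain rfl := wAdj_root_right.1 (hS ha)
      exact h ha
  -- Balance at the root turns its in-degree, 0 or 1, into its out-degree.
  rw [← hE] at hin
  rcases hin with ⟨h1, h2⟩ | ⟨h1, h2⟩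
  · obtain ⟨b, hb⟩ := Set.ncard_eq_one.1 h1
    have hb' : ∀ a, S.Adj (.copy v w e v hv) a ↔ b = a := fun a =>
      (Set.ext_iff.1 hb a).trans eq_comm
    rcases wAdj_root_left.1 (hS ((hb' b).2 rfl)) with ⟨x, h, hx, rfl⟩ | ⟨x, h, rfl⟩
    · refine ⟨x, hx, fun _ => iff_of_true h2 (ne_tail_of_mem_direct e h), fun y _ _ hy => ?_,
        fun y hy _ => ?_⟩
      · rw [hb']
        simp
      · rw [hb']
        refine iff_of_false (by simp) ?_
        rintro rfl
        exact h.2 hy.1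
    · refine ⟨x, mem_symmDiff_of_mem_mid h, fun _ => iff_of_true h2 (ne_tail_of_mem_mid h),
        fun y hy _ _ => ?_, fun y hy _ => ?_⟩
      · rw [hb']
        refine iff_of_false (by simp) ?_
        rintro rfl
        exact hy.2 h.1
      · rw [hb']
        simp
  · have hb : ∀ a, ¬ S.Adj (.copy v w e v hv) a := by
      rw [outDeg, Set.ncard_eq_zero, Set.eq_empty_iff_forall_notMem] at h1
      exact h1
    exact ⟨v, hv, fun _ => iff_of_false h2 (by simp),
      fun y hy _ _ => iff_of_false (hb _) (ne_tail_of_mem_direct e hy).symm,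
      fun y hy _ => iff_of_false (hb _) (ne_tail_of_mem_mid hy).symm⟩

/-- Once the edges at v^{vw} are known, balance propagates along each path: every later vertex
before x* has a single possible in-edge and a single possible out-edge. -/
lemma exists_flow_eq (hD : ∀ v w, D.Adj v w → ¬ D.Adj w v) {S : Digraph (WVertex D)}
    (hS : S ≤ W D) (hE : IsEulerian S) : ∃ c, IsSelection c ∧ flow c = S := by
  choose c hc henter hdirect hmid using exists_sector_selection hD hS hE
  refine ⟨c, hc, ?_⟩
  have hfrom : ∀ v w e x h hx,
      S.Adj (.mid v w e x h) (.copy v w e x hx) ↔ c ⟨(v, w), e⟩ = x := by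
    intro v w e x h hx
    have hv := mem_symmDiff_nbr_tail hD e
    rw [adj_iff_adj_of_outDeg_eq_inDeg (hE _) (fun b hb => (wAdj_mid_left hx).1 (hS hb))
      (fun b hb => (wAdj_mid_right hv).1 (hS hb))]
    exact hmid ⟨(v, w), e⟩ x h hv
  have hleave : ∀ v w e x hx, x ≠ v →
      (S.Adj (.copy v w e x hx) (.star x) ↔ c ⟨(v, w), e⟩ = x) := by
    intro v w e x hx hne
    have hv := mem_symmDiff_nbr_tail hD e
    have hout : ∀ b, S.Adj (.copy v w e x hx) b → b = .star x := fun b hb =>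
      (wAdj_copy_left hne).1 (hS hb)
    rcases mem_direct_or_mem_mid hx hne with h | h
    · rw [adj_iff_adj_of_outDeg_eq_inDeg (hE _) hout
        (fun b hb => (wAdj_copy_right_of_direct h hv).1 (hS hb))]
      exact hdirect ⟨(v, w), e⟩ x h hv hx
    · rw [adj_iff_adj_of_outDeg_eq_inDeg (hE _) hout
        (fun b hb => (wAdj_copy_right_of_mid h).1 (hS hb))]
      exact hfrom v w e x h hx
  have key : ∀ a b, WAdj D a b → (S.Adj a b ↔ Active c a ∧ Active c b) := by
    intro a b hab
    cases hab with
    | direct v w e x h hv hx =>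
      have hne := ne_tail_of_mem_direct e h
      rw [active_root, active_copy hne, hdirect ⟨(v, w), e⟩ x h hv hx]
      exact ⟨fun h => ⟨h ▸ hne, h⟩, And.right⟩
    | toMid v w e x h hv =>
      have hne := ne_tail_of_mem_mid h
      rw [active_root, active_mid, hmid ⟨(v, w), e⟩ x h hv]
      exact ⟨fun h => ⟨h ▸ hne, h⟩, And.right⟩
    | fromMid v w e x h hx =>
      rw [active_copy (ne_tail_of_mem_mid h), active_mid, hfrom, and_self]
    | enter v w e hv =>
      rw [active_root, henter ⟨(v, w), e⟩ hv]
      exact ⟨fun h => ⟨trivial, h⟩, And.right⟩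
    | leave v w e x hx hne =>
      rw [active_copy hne, hleave v w e x hx hne]
      exact ⟨fun h => ⟨h, trivial⟩, And.left⟩
  ext a b
  exact ⟨fun h => (key a b h.1).2 h.2, fun h => ⟨hS h, (key a b (hS h)).1 h⟩⟩

end Eulerian

/-! ### Counting edges sector by sector -/

section Parity

variable {V : Type*} {D : Digraph V}

/-- The directed edge in whose sector a vertex of `𝒲(D)` lies. -/
def WVertex.sector : WVertex D → Option (Edge D)
  | .star _ => none
  | .copy v w e _ _ => some ⟨(v, w), e⟩
  | .mid v w e _ _ => some ⟨(v, w), e⟩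

/-- The directed edge in whose sector an edge of `𝒲(D)` lies. -/
def edgeSector (p : WVertex D × WVertex D) : Option (Edge D) :=
  p.1.sector <|> p.2.sector

lemma edgeSector_ne_none {a b : WVertex D} (h : WAdj D a b) : edgeSector (a, b) ≠ none := by
  cases h <;> simp [edgeSector, WVertex.sector]

/-- The edges of `flow c` in the sector of `e`. -/
def sectorEdges (c : Edge D → V) (e : Edge D) : Set (WVertex D × WVertex D) :=
  {p | (flow c).Adj p.1 p.2 ∧ edgeSector p = some e}

lemma sectorEdges_eq_empty {c : Edge D → V} {v w : V} {e : D.Adj v w} (h : c ⟨(v, w), e⟩ = v) :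
    sectorEdges c ⟨(v, w), e⟩ = ∅ := by
  rw [Set.eq_empty_iff_forall_notMem]
  rintro ⟨a, b⟩ ⟨⟨hab, ha, hb⟩, hs⟩
  dsimp only at hab ha hb
  cases hab with
  | direct =>
    simp only [edgeSector, WVertex.sector, Option.orElse_eq_orElse, Option.orElse_some,
      Option.some.injEq, Subtype.mk.injEq, Prod.mk.injEq] at hs
    obtain ⟨rfl, rfl⟩ := hs
    exact active_root.1 ha h
  | toMid =>
    simp only [edgeSector, WVertex.sector, Option.orElse_eq_orElse, Option.orElse_some,
      Option.some.injEq, Subtype.mk.injEq, Prod.mk.injEq] at hs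
    obtain ⟨rfl, rfl⟩ := hs
    exact active_root.1 ha h
  | fromMid _ _ _ _ h' =>
    simp only [edgeSector, WVertex.sector, Option.orElse_eq_orElse, Option.orElse_some,
      Option.some.injEq, Subtype.mk.injEq, Prod.mk.injEq] at hs
    obtain ⟨rfl, rfl⟩ := hs
    exact ne_tail_of_mem_mid h' ((active_mid.1 ha).symm.trans h)
  | enter =>
    simp only [edgeSector, WVertex.sector, Option.orElse_eq_orElse, Option.orElse_none,
      Option.some.injEq, Subtype.mk.injEq, Prod.mk.injEq] at hs
    obtain ⟨rfl, rfl⟩ := hs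
    exact active_root.1 hb h
  | leave _ _ _ _ _ hne =>
    simp only [edgeSector, WVertex.sector, Option.orElse_eq_orElse, Option.orElse_some,
      Option.some.injEq, Subtype.mk.injEq, Prod.mk.injEq] at hs
    obtain ⟨rfl, rfl⟩ := hs
    exact hne (((active_copy hne).1 ha).symm.trans h)

lemma sectorEdges_eq_of_direct {c : Edge D → V} {v w x : V} {e : D.Adj v w}
    (hv : v ∈ symmDiff (nbr D v) (nbr D w)) (hx : x ∈ symmDiff (nbr D v) (nbr D w))
    (h : x ∈ nbr D v \ nbr D w) (hc : c ⟨(v, w), e⟩ = x) :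
    sectorEdges c ⟨(v, w), e⟩ =
      {(.star v, .copy v w e v hv), (.copy v w e v hv, .copy v w e x hx),
        (.copy v w e x hx, .star x)} := by
  have hne := ne_tail_of_mem_direct e h
  have hroot : Active c (.copy v w e v hv) := active_root.2 (hc ▸ hne)
  have hcopy : Active c (.copy v w e x hx) := (active_copy hne).2 hc
  ext ⟨a, b⟩
  simp only [Set.mem_insert_iff, Set.mem_singleton_iff]
  constructor
  · rintro ⟨⟨hab, ha, hb⟩, hs⟩
    dsimp only at hab ha hb
    cases hab <;> simp only [edgeSector, WVertex.sector, Option.orElse_eq_orElse,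
      Option.orElse_none, Option.orElse_some,
      Option.some.injEq, Subtype.mk.injEq, Prod.mk.injEq] at hs <;> obtain ⟨rfl, rfl⟩ := hs
    case direct y hy _ _ =>
      obtain rfl := ((active_copy (ne_tail_of_mem_direct e hy)).1 hb).symm.trans hc
      exact Or.inr (Or.inl rfl)
    case toMid y hy _ =>
      obtain rfl := (active_mid.1 hb).symm.trans hc
      exact (h.2 hy.1).elim
    case fromMid y hy _ =>
      obtain rfl := (active_mid.1 ha).symm.trans hc
      exact (h.2 hy.1).elim
    case enter => exact Or.inl rfl
    case leave y hy hyv =>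
      obtain rfl := ((active_copy hyv).1 ha).symm.trans hc
      exact Or.inr (Or.inr rfl)
  · simp only [Prod.mk.injEq]
    rintro (⟨rfl, rfl⟩ | ⟨rfl, rfl⟩ | ⟨rfl, rfl⟩)
    · exact ⟨⟨.enter .., trivial, hroot⟩, rfl⟩
    · exact ⟨⟨.direct _ _ _ _ h _ _, hroot, hcopy⟩, rfl⟩
    · exact ⟨⟨.leave _ _ _ _ _ hne, hcopy, trivial⟩, rfl⟩

lemma sectorEdges_eq_of_mid {c : Edge D → V} {v w x : V} {e : D.Adj v w}
    (hv : v ∈ symmDiff (nbr D v) (nbr D w)) (hx : x ∈ symmDiff (nbr D v) (nbr D w))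
    (h : x ∈ nbr D w \ insert v (nbr D v)) (hc : c ⟨(v, w), e⟩ = x) :
    sectorEdges c ⟨(v, w), e⟩ =
      {(.star v, .copy v w e v hv), (.copy v w e v hv, .mid v w e x h),
        (.mid v w e x h, .copy v w e x hx), (.copy v w e x hx, .star x)} := by
  have hne := ne_tail_of_mem_mid h
  have hroot : Active c (.copy v w e v hv) := active_root.2 (hc ▸ hne)
  have hcopy : Active c (.copy v w e x hx) := (active_copy hne).2 hc
  ext ⟨a, b⟩
  simp only [Set.mem_insert_iff, Set.mem_singleton_iff]
  constructor
  · rintro ⟨⟨hab, ha, hb⟩, hs⟩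
    dsimp only at hab ha hb
    cases hab <;> simp only [edgeSector, WVertex.sector, Option.orElse_eq_orElse,
      Option.orElse_none, Option.orElse_some,
      Option.some.injEq, Subtype.mk.injEq, Prod.mk.injEq] at hs <;> obtain ⟨rfl, rfl⟩ := hs
    case direct y hy _ _ =>
      obtain rfl := ((active_copy (ne_tail_of_mem_direct e hy)).1 hb).symm.trans hc
      exact (hy.2 h.1).elim
    case toMid y hy _ =>
      obtain rfl := (active_mid.1 hb).symm.trans hc
      exact Or.inr (Or.inl rfl)
    case fromMid y hy _ =>
      obtain rfl := (active_mid.1 ha).symm.trans hc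
      exact Or.inr (Or.inr (Or.inl rfl))
    case enter => exact Or.inl rfl
    case leave y hy hyv =>
      obtain rfl := ((active_copy hyv).1 ha).symm.trans hc
      exact Or.inr (Or.inr (Or.inr rfl))
  · simp only [Prod.mk.injEq]
    rintro (⟨rfl, rfl⟩ | ⟨rfl, rfl⟩ | ⟨rfl, rfl⟩ | ⟨rfl, rfl⟩)
    · exact ⟨⟨.enter .., trivial, hroot⟩, rfl⟩
    · exact ⟨⟨.toMid .., hroot, hc⟩, rfl⟩
    · exact ⟨⟨.fromMid .., hc, hcopy⟩, rfl⟩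
    · exact ⟨⟨.leave _ _ _ _ _ hne, hcopy, trivial⟩, rfl⟩

variable [Finite V]

open Classical in
-- A sector contains 0, 3 or 4 edges of the flow, and 3 occurs exactly when the choice is a neighbor
-- of the tail. The detour through y^{vw}_x serves to make the other paths even.
lemma neg_one_pow_ncard_sectorEdges (hD : ∀ v w, D.Adj v w → ¬ D.Adj w v) {c : Edge D → V}
    (hc : IsSelection c) (e : Edge D) :
    (-1 : ℤ) ^ (sectorEdges c e).ncard = if c e ∈ nbr D e.1.1 then -1 else 1 := by
  have hx := hc e
  obtain ⟨⟨v, w⟩, e⟩ := e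
  dsimp only at hx ⊢
  have hv := mem_symmDiff_nbr_tail hD e
  by_cases hne : c ⟨(v, w), e⟩ = v
  · have hvv : v ∉ nbr D v := by
      rintro (h | h) <;> exact hD _ _ h h
    rw [sectorEdges_eq_empty hne, hne, if_neg hvv]
    simp
  · rcases mem_direct_or_mem_mid hx hne with h | h
    · rw [sectorEdges_eq_of_direct hv hx h rfl, if_pos h.1, Set.ncard_insert_of_notMem,
        Set.ncard_pair]
      · norm_num
      · simp
      · simp
    · rw [sectorEdges_eq_of_mid hv hx h rfl, if_neg fun h' => h.2 (Or.inr h'),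
        Set.ncard_insert_of_notMem, Set.ncard_insert_of_notMem, Set.ncard_pair]
      · norm_num
      · simp
      · simp
      · simp

open Classical in
lemma neg_one_pow_numEdges_flow [Fintype (Edge D)] (hD : ∀ v w, D.Adj v w → ¬ D.Adj w v)
    {c : Edge D → V} (hc : IsSelection c) :
    (-1 : ℤ) ^ numEdges (flow c) = ∏ e : Edge D, if c e ∈ nbr D e.1.1 then -1 else 1 := by
  have h : numEdges (flow c) = ∑ e : Edge D, (sectorEdges c e).ncard := by
    let _ := Fintype.ofFinite (WVertex D)
    rw [numEdges, Set.ncard_eq_toFinset_card',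
      Finset.card_eq_sum_card_fiberwise (f := edgeSector)
        (t := Finset.univ.map (Function.Embedding.some (α := Edge D))), Finset.sum_map]
    · refine Finset.sum_congr rfl fun e _ => ?_
      rw [Set.ncard_eq_toFinset_card']
      congr 1
      ext p
      rw [Set.mem_toFinset]
      simp [sectorEdges]
    -- No edge of 𝒲(D) joins two star vertices, so every edge lies in some sector.
    · rintro ⟨a, b⟩ hp
      obtain ⟨e, he⟩ := Option.ne_none_iff_exists.1
        (edgeSector_ne_none (a := a) (b := b) (by simpa using (Set.mem_toFinset.1 hp).1))
      simp [← he]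
  rw [h, ← Finset.prod_pow_eq_pow_sum]
  exact Finset.prod_congr rfl fun e _ => neg_one_pow_ncard_sectorEdges hD hc e

end Parity

/-! ### EE − EO as a signed sum over selections -/

section Count

variable {V : Type*} [Finite V] {D : Digraph V}

instance finite_digraph {α : Type*} [Finite α] : Finite (Digraph α) :=
  Finite.of_injective Digraph.Adj fun _ _ h => Digraph.ext h

open Classical in
lemma EE_sub_EO {α : Type*} [Finite α] [Fintype (Digraph α)] (H : Digraph α) :
    (EE H : ℤ) - EO H =
      ∑ S ∈ Finset.univ.filter (fun S : Digraph α => S ≤ H ∧ IsEulerian S),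
        (-1 : ℤ) ^ numEdges S := by
  rw [← Finset.sum_filter_add_sum_filter_not _ (fun S => Even (numEdges S)),
    Finset.sum_congr (g := fun _ => (1 : ℤ)) rfl fun S hS => (Finset.mem_filter.1 hS).2.neg_one_pow,
    Finset.sum_congr (g := fun _ => (-1 : ℤ))
      (s₁ := Finset.filter (fun S => ¬ Even (numEdges S)) _) rfl
      fun S hS => (Nat.not_even_iff_odd.1 (Finset.mem_filter.1 hS).2).neg_one_pow]
  simp only [Finset.sum_const, Finset.filter_filter, EE, EO, Set.ncard_eq_toFinset_card',
    Set.toFinset_ofPred, Nat.not_even_iff_odd, and_assoc]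
  simp [sub_eq_add_neg]

open Classical in
lemma EE_W_sub_EO_W [Fintype V] (hD : ∀ v w, D.Adj v w → ¬ D.Adj w v) :
    (EE (W D) : ℤ) - EO (W D) =
      ∑ c : Edge D → V with IsSelection c ∧ ∀ x, {e | c e = x}.ncard = outDeg D x,
        ∏ e : Edge D, if c e ∈ nbr D e.1.1 then -1 else 1 := by
  let _ := Fintype.ofFinite (Digraph (WVertex D))
  rw [EE_sub_EO]
  symm
  refine Finset.sum_bij (fun c _ => flow c) ?_ ?_ ?_ ?_
  · intro c hc
    simp only [Finset.mem_filter, Finset.mem_univ, true_and] at hc ⊢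
    exact ⟨flow_le c, (isEulerian_flow_iff hD hc.1).2 hc.2⟩
  · intro c hc c' hc' h
    exact flow_injOn (Finset.mem_filter.1 hc).2.1 (Finset.mem_filter.1 hc').2.1 h
  · intro S hS
    simp only [Finset.mem_filter, Finset.mem_univ, true_and] at hS
    obtain ⟨c, hc, rfl⟩ := exists_flow_eq hD hS.1 hS.2
    exact ⟨c, by simpa using ⟨hc, (isEulerian_flow_iff hD hc).1 hS.2⟩, rfl⟩
  · intro c hc
    exact (neg_one_pow_numEdges_flow hD (Finset.mem_filter.1 hc).2.1).symm

end Count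

/-! ### Coefficients of products of linear forms -/

section Polynomial

open MvPolynomial

lemma prod_sum_C_mul_X {σ ι : Type*} [Fintype ι] [DecidableEq ι] (T : ι → Finset σ)
    (s : ι → σ → ℤ) :
    ∏ i, ∑ x ∈ T i, C (s i x) * X x =
      ∑ c ∈ Fintype.piFinset T,
        monomial (∑ i, Finsupp.single (c i) 1) (∏ i, s i (c i)) := by
  rw [Finset.prod_univ_sum]
  refine Finset.sum_congr rfl fun c _ => ?_
  rw [monomial_sum_prod]
  exact Finset.prod_congr rfl fun i _ => C_mul_X_eq_monomial

open Classical in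
lemma coeff_prod_sum_C_mul_X {σ ι : Type*} [Fintype ι] (T : ι → Finset σ) (s : ι → σ → ℤ)
    (d : σ →₀ ℕ) :
    coeff d (∏ i, ∑ x ∈ T i, C (s i x) * X x) =
      ∑ c ∈ Fintype.piFinset T with ∀ x, {i | c i = x}.ncard = d x, ∏ i, s i (c i) := by
  rw [prod_sum_C_mul_X, coeff_sum, Finset.sum_filter]
  refine Finset.sum_congr rfl fun c _ => ?_
  rw [coeff_monomial]
  congr 1
  rw [Finsupp.ext_iff, eq_iff_iff]
  refine forall_congr' fun x => ?_
  rw [Finsupp.finsetSum_apply, Set.ncard_eq_toFinset_card']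
  simp [Finsupp.single_apply]

lemma totalDegree_prod_sum_C_mul_X_le {σ ι : Type*} [Fintype ι] (T : ι → Finset σ)
    (s : ι → σ → ℤ) :
    (∏ i, ∑ x ∈ T i, C (s i x) * X x : MvPolynomial σ ℤ).totalDegree ≤ Fintype.card ι := by
  refine (totalDegree_finsetProd _ _).trans ?_
  rw [← Finset.card_univ, Finset.card_eq_sum_ones]
  refine Finset.sum_le_sum fun i _ => totalDegree_finsetSum_le fun x _ => ?_
  rw [C_mul_X_eq_monomial]
  refine (totalDegree_monomial_le _ _).trans ?_
  simp

/-- The terms over A ∩ B cancel in the difference. This lets the factors of `P` range over symmetric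
differences, matching selections. -/
lemma sum_symmDiff_ite {σ : Type*} [DecidableEq σ] (A B : Finset σ) (f : σ → ℤ) :
    ∑ x ∈ symmDiff A B, (if x ∈ A then 1 else -1) * f x = ∑ x ∈ A, f x - ∑ x ∈ B, f x := by
  have h : Disjoint (A \ B) (B \ A) := disjoint_sdiff_sdiff
  rw [← Finset.sum_sdiff_sub_sum_sdiff, symmDiff, Finset.sup_eq_union, Finset.sum_union h,
    sub_eq_add_neg, ← Finset.sum_neg_distrib]
  congr 1
  · exact Finset.sum_congr rfl fun x hx => by simp [(Finset.mem_sdiff.1 hx).1]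
  · exact Finset.sum_congr rfl fun x hx => by simp [(Finset.mem_sdiff.1 hx).2]

end Polynomial

end AddCol

open AddCol MvPolynomial in
theorem theorem4p2 {V : Type*} [Fintype V] (G : SimpleGraph V) (D : Digraph V)
    (hD : AddCol.IsOrientation D G) (L : V → Finset ℕ+)
    (hL : ∀ v, (L v).card = AddCol.outDeg D v + 1)
    (hW : AddCol.EE (AddCol.W D) ≠ AddCol.EO (AddCol.W D)) :
    ∃ l : V → ℕ+, AddCol.IsAdditiveColoring G l ∧ ∀ v, l v ∈ L v := by
  classical
  let T : Edge D → Finset V := fun e => symmDiff (G.neighborFinset e.1.1) (G.neighborFinset e.1.2)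
  let s : Edge D → V → ℤ := fun e x => if x ∈ G.neighborFinset e.1.1 then 1 else -1
  let P : MvPolynomial V ℤ := ∏ e, ∑ x ∈ T e, C (s e x) * X x
  let d : V →₀ ℕ := Finsupp.equivFunOnFinite.symm (outDeg D)
  have hN : ∀ v, (G.neighborFinset v : Set V) = nbr D v := by
    intro v
    ext x
    simp [nbr, hD.1]
  have hN' : ∀ v x, x ∈ G.neighborFinset v ↔ x ∈ nbr D v := fun v x => by
    rw [← hN, Finset.mem_coe]
  have hT : ∀ c : Edge D → V, (∀ e, c e ∈ T e) ↔ IsSelection c := by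
    intro c
    refine forall_congr' fun e => ?_
    rw [← hN, ← hN, ← Finset.coe_symmDiff, Finset.mem_coe]
  have hcoeff : coeff d P = (-1) ^ Fintype.card (Edge D) * ((EE (W D) : ℤ) - EO (W D)) := by
    rw [EE_W_sub_EO_W hD.2, coeff_prod_sum_C_mul_X, Finset.mul_sum]
    refine Finset.sum_congr ?_ fun c _ => ?_
    · ext c
      simp only [Finset.mem_filter, Finset.mem_univ, true_and, Fintype.mem_piFinset, hT]
      rfl
    -- The linear form gives +1 on neighbors of the tail, where the path is odd, and −1 elsewhere,
    -- where it is even; the two signs thus differ at every edge, whence (−1)^{|E(D)|}.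
    · rw [← Finset.card_univ, ← Finset.prod_const, ← Finset.prod_mul_distrib]
      refine Finset.prod_congr rfl fun e _ => ?_
      simp only [s, hN']
      split_ifs <;> rfl
  have hne : coeff d P ≠ 0 := by
    rw [hcoeff]
    exact mul_ne_zero (by simp) (sub_ne_zero.2 (by exact_mod_cast hW))
  -- Grouping the edges by their tails sums the out-degrees.
  have hdeg : d.degree = Fintype.card (Edge D) := by
    rw [Finsupp.degree_eq_sum, ← Finset.card_univ,
      Finset.card_eq_sum_card_fiberwise (f := fun e : Edge D => e.1.1) (t := Finset.univ)
        (fun _ _ => Finset.mem_coe.2 (Finset.mem_univ _))]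
    refine Finset.sum_congr rfl fun x _ => ?_
    simp [d, outDeg_eq_ncard_edge, Set.ncard_eq_toFinset_card']
  have htot : P.totalDegree = d.degree := by
    refine le_antisymm (hdeg ▸ totalDegree_prod_sum_C_mul_X_le T s) ?_
    exact le_totalDegree (mem_support_iff.2 hne)
  let f : ℕ+ ↪ ℤ := ⟨fun n => (n : ℤ), fun m n h => by simpa using h⟩
  -- The exponent of X_v is d⁺(v), strictly below the list size d⁺(v) + 1.
  obtain ⟨z, hz, hz'⟩ := combinatorial_nullstellensatz_exists_eval_nonzero P d hne htot
    (fun v => (L v).map f) (fun v => by simp [hL, d])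
  choose l hl hlz using fun v => Finset.mem_map.1 (hz v)
  refine ⟨l, ?_, hl⟩
  have key : ∀ v w, D.Adj v w →
      ∑ x ∈ G.neighborFinset v, (l x : ℕ) ≠ ∑ x ∈ G.neighborFinset w, (l x : ℕ) := by
    intro v w e heq
    rw [map_prod, Finset.prod_ne_zero_iff] at hz'
    -- Equal neighborhood sums at the ends of vw would make the factor of `P` for this edge vanish
    -- at `z`.
    apply hz' ⟨(v, w), e⟩ (Finset.mem_univ _)
    have h := sum_symmDiff_ite (G.neighborFinset v) (G.neighborFinset w) z
    have hz2 : ∀ x, z x = ((l x : ℕ) : ℤ) := fun x => (hlz x).symm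
    have h2 : ∀ u, ∑ x ∈ G.neighborFinset u, z x =
        ((∑ x ∈ G.neighborFinset u, (l x : ℕ) : ℕ) : ℤ) := fun u => by
      rw [Nat.cast_sum]
      exact Finset.sum_congr rfl fun x _ => hz2 x
    rw [h2, h2, heq, sub_self] at h
    simpa only [T, s, map_sum, map_mul, MvPolynomial.eval_C, MvPolynomial.eval_X] using h
  intro u v huv
  rcases (hD.1 u v).1 huv with e | e
  · convert key u v e
  · convert (key v u e).symm
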